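/- Theorem 3.4. Let $\mu\in\mathbb{R}$, $\mu\ne 0$, and for real $\lambda$ put $\xi(\lambda)=\sqrt{1+8\lambda/\mu^2}$ (principal square root). For complex $a,b$ let $W_{a,b}$ be the Whittaker function on $(0,\infty)$, i.e. the solution of $$w''(z)+\Bigl\{-\tfrac14+\tfrac{a}{z}+\tfrac{1/4-b^2}{z^2}\Bigr\}w(z)=0,\qquad z>0,$$ with $w(z)\sim e^{-z/2}z^{a}$ as $z\to+\infty$. For $z>0$ let $E_1(z)=\int_z^\infty \frac{e^{-y}}{y}\,dy$, let $$G(z)=G^{3,1}_{2,3}\Bigl(\begin{smallmatrix}0,1\\0,0,0\end{smallmatrix}\Big|\,z\Bigr)=\frac1{2\pi i}\int_{\sigma-i\infty}^{\sigma+i\infty}\frac{\Gamma(-s)^3\,\Gamma(1+s)}{\Gamma(1-s)}\,z^s\,ds ,$$ where $\sigma\in(-1,0)$ is arbitrary, be the Meijer $G$-function, and let $$L(z)=e^zE_1(z)-1+zG(z).$$ Then for every fixed $x>0$, as $\lambda\to0$ through real values, $$W_{1,\xi(\lambda)/2}\Bigl(\tfrac{2}{\mu^2x}\Bigr)=\frac{2}{\mu^2}\,e^{-\frac{1}{\mu^2x}}\Bigl\{\frac1x+\lambda+\frac{2}{\mu^2}L\Bigl(\tfrac{2}{\mu^2x}\Bigr)\lambda^2+\Bigl(\frac{2}{\mu^2}\Bigr)^2\Bigl[G\Bigl(\tfrac{2}{\mu^2x}\Bigr)-2L\Bigl(\tfrac{2}{\mu^2x}\Bigr)\Bigr]\lambda^3\Bigr\}+\mathcal{O}(\lambda^4).$$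 The expansion also holds at $x=0$ when both sides are read as limits for $x\to0^+$: for every real $\lambda$, the left-hand side and the explicit part of the right-hand side (the term without $\mathcal{O}(\lambda^4)$) both tend to $0$ as $x\to0^+$. -/

import Mathlib

open Filter Topology Asymptotics MeasureTheory

noncomputable section

/-- `IsWhittakerW a b w` : on the half-line `z > 0`, the function `w` is the Whittaker function
`W_{a,b}`, i.e. the solution of Whittaker's equation
`w'' + (-1/4 + a / z + (1/4 - b²) / z²) w = 0`
that is recessive at infinity and normalised by `w(z) ~ e^{-z/2} z^a` as `z → +∞`.
(Every solution that is not a multiple of this one grows like `e^{z/2} z^{-a}`, so these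
conditions determine `w` on `z > 0`.) -/
structure IsWhittakerW (a b : ℂ) (w : ℝ → ℂ) : Prop where
  differentiableAt : ∀ z : ℝ, 0 < z → DifferentiableAt ℝ w z
  differentiableAt_deriv : ∀ z : ℝ, 0 < z → DifferentiableAt ℝ (deriv w) z
  equation : ∀ z : ℝ, 0 < z →
    deriv (deriv w) z + (-1 / 4 + a / (z : ℂ) + (1 / 4 - b ^ 2) / (z : ℂ) ^ 2) * w z = 0
  normalized : Tendsto (fun z : ℝ => w z / (Complex.exp (-(z : ℂ) / 2) * (z : ℂ) ^ a))
    atTop (𝓝 1)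

open Classical in
/-- The Whittaker function `W_{a,b}(z)` for complex parameters `a`, `b` and real `z > 0`
(its values at `z ≤ 0` are meaningless). -/
def whittakerW (a b : ℂ) : ℝ → ℂ :=
  if h : ∃ w, IsWhittakerW a b w then h.choose else 0

/-- `ξ(lam) = √(1 + 8 lam / μ²)`, the principal square root; it is purely imaginary for
`lam < -μ² / 8`. -/
def xi (μ lam : ℝ) : ℂ := ((1 + 8 / μ ^ 2 * lam : ℝ) : ℂ) ^ (1 / 2 : ℂ)

/-- The exponential integral `E₁(x) = ∫_x^∞ e^{-y} / y dy`, for `x > 0`. -/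
def E1 (x : ℝ) : ℝ := ∫ y in Set.Ioi x, Real.exp (-y) / y

/-- The Mellin-Barnes kernel of the Meijer function `G^{m,n}_{p,q}(a; b | z)`. The indices are
shifted by one: `a 0, …, a (n - 1)` are the parameters `a_1, …, a_n`, and so on. -/
def meijerKernel (m n : ℕ) {p q : ℕ} (a : Fin p → ℂ) (b : Fin q → ℂ) (s : ℂ) : ℂ :=
  ((∏ k : Fin q with k.val < m, Complex.Gamma (b k - s)) *
      ∏ j : Fin p with j.val < n, Complex.Gamma (1 - a j + s)) /
    ((∏ k : Fin q with m ≤ k.val, Complex.Gamma (1 - b k + s)) *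
      ∏ j : Fin p with n ≤ j.val, Complex.Gamma (a j - s))

/-- The vertical line `Re s = σ` separates the poles of the factors `Γ(1 - a_j + s)`, `j ≤ n`
(on its left) from those of the factors `Γ(b_k - s)`, `k ≤ m` (on its right). -/
def SeparatesPoles (m n : ℕ) {p q : ℕ} (a : Fin p → ℂ) (b : Fin q → ℂ) (σ : ℝ) : Prop :=
  (∀ j : Fin p, j.val < n → (a j).re - 1 < σ) ∧ ∀ k : Fin q, k.val < m → σ < (b k).re

/-- The Meijer function `G^{m,n}_{p,q}(a; b | z)` for `z > 0`, as the Mellin-Barnes integral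
`(1 / 2πi) ∫ (kernel s) z^s ds` over the line `Re s = σ` (with `s = σ + it`, `ds = i dt`). -/
def meijerG (σ : ℝ) (m n : ℕ) {p q : ℕ} (a : Fin p → ℂ) (b : Fin q → ℂ) (z : ℝ) : ℂ :=
  1 / (2 * (Real.pi : ℂ)) *
    ∫ t : ℝ, meijerKernel m n a b ((σ : ℂ) + (t : ℂ) * Complex.I) *
      (z : ℂ) ^ ((σ : ℂ) + (t : ℂ) * Complex.I)

/-- `G^{3,1}_{2,3}(0, 1; 0, 0, 0 | z)`, with contour `Re s = σ`. -/
def specialG (σ z : ℝ) : ℂ := meijerG σ 3 1 ![0, 1] ![0, 0, 0] z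

/-- `L(z) = e^z E₁(z) - 1 + z G(z)`. -/
def funL (σ z : ℝ) : ℂ := (Real.exp z * E1 z - 1 : ℝ) + z * specialG σ z

/-- The third-order expansion
`(2/μ²) e^{-1/(μ²x)} {1/x + lam + (2/μ²) L lam² + (2/μ²)² [G - 2 L] lam³}`,
where `L` and `G` are taken at `2 / (μ² x)`. -/
def thirdOrderExpansion (σ μ x lam : ℝ) : ℂ :=
  (2 / μ ^ 2 * Real.exp (-1 / (μ ^ 2 * x)) : ℝ) *
    (1 / (x : ℂ) + lam + 2 / (μ : ℂ) ^ 2 * funL σ (2 / (μ ^ 2 * x)) * (lam : ℂ) ^ 2 +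
      (2 / (μ : ℂ) ^ 2) ^ 2 *
        (specialG σ (2 / (μ ^ 2 * x)) - 2 * funL σ (2 / (μ ^ 2 * x))) * (lam : ℂ) ^ 3)

end

/-! Put `ε = 2λ/μ²` and write a solution as `w = e^{-z/2} z u`. With `a = 1` and `1/4 - b² = -ε`,
Whittaker's equation becomes `(z² e^{-z} u')' = ε e^{-z} u`, and the normalisation becomes `u(∞) =
1`. Integrating twice from infinity gives `u = 1 + ε T u` for a Volterra operator `T`, so `u = ∑ εⁿ
Tⁿ1`. By `volterraIter_continuousOn_and_bounds`, `0 ≤ Tⁿ1 ≤ z⁻ⁿ/n!`; hence the series converges for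
every `ε`, and `abs_volterraSol_sub_le` makes the remainder after four terms `O(λ⁴)`.

The claimed expansion is the four-term partial sum: `T1 = 1/z`, `T²1 = L/z`, `T³1 = (G - 2L)/z`,
where `G(z) = ∫_z^∞ eᵘ E₁(u)/u du`. This `G` is the Meijer function because its Mellin transform is
`Γ(s)² Γ(1-s)/s`, and Mellin inversion returns the Mellin-Barnes integral (`specialG_eq_tailExpE1`).

A Wronskian argument (`IsWhittakerW.eq_ofReal`) identifies the series solution with the Whittaker
function. The limit `x → 0+` is `z → ∞`, where `e^{-z/2} z` vanishes and both series factors tend to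
`1`. -/

/-! ### Integrals over half-lines -/

theorem hasDerivAt_integral_Ioi {h : ℝ → ℝ} {z : ℝ} (hz : 0 < z) (hc : ContinuousOn h (Set.Ioi 0))
    (hi : ∀ a : ℝ, 0 < a → IntegrableOn h (Set.Ioi a)) :
    HasDerivAt (fun s => ∫ t in Set.Ioi s, h t) (-h z) z := by
  have ha : 0 < z / 2 := by positivity
  have hcz : ContinuousAt h z := hc.continuousAt (Ioi_mem_nhds hz)
  have hii : IntervalIntegrable h volume (z / 2) z :=
    (intervalIntegrable_iff_integrableOn_Ioc_of_le (by linarith)).2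
      ((hi _ ha).mono_set Set.Ioc_subset_Ioi_self)
  have hd := intervalIntegral.integral_hasDerivAt_right hii
    (hc.stronglyMeasurableAtFilter isOpen_Ioi z hz) hcz
  refine (hd.const_sub (∫ t in Set.Ioi (z / 2), h t)).congr_of_eventuallyEq ?_
  filter_upwards [Ioi_mem_nhds (show z / 2 < z by linarith)] with s hs
  have hs' : z / 2 < s := hs
  rw [← intervalIntegral.integral_interval_add_Ioi (hi _ ha) (hi s (ha.trans hs'))]
  ring

theorem integrableOn_Ioi_inv_pow (n : ℕ) {z : ℝ} (hz : 0 < z) :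
    IntegrableOn (fun s : ℝ => (s ^ (n + 2))⁻¹) (Set.Ioi z) := by
  have h := integrableOn_Ioi_rpow_of_lt (a := -((n + 2 : ℕ) : ℝ)) (by push_cast; linarith) hz
  refine h.congr_fun (fun s hs => ?_) measurableSet_Ioi
  have hs : 0 < s := hz.trans hs
  simp only
  rw [Real.rpow_neg hs.le, Real.rpow_natCast]

theorem integral_Ioi_inv_pow (n : ℕ) {z : ℝ} (hz : 0 < z) :
    ∫ s in Set.Ioi z, (s ^ (n + 2))⁻¹ = (z ^ (n + 1) * (n + 1))⁻¹ := by
  have h := integral_Ioi_rpow_of_lt (a := -((n + 2 : ℕ) : ℝ)) (by push_cast; linarith) hz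
  have h2 : ∫ s in Set.Ioi z, (s ^ (n + 2))⁻¹ = ∫ s in Set.Ioi z, s ^ (-((n + 2 : ℕ) : ℝ)) := by
    refine setIntegral_congr_fun measurableSet_Ioi (fun s hs => ?_)
    have hs : 0 < s := hz.trans hs
    rw [Real.rpow_neg hs.le, Real.rpow_natCast]
  rw [h2, h]
  have h3 : -((n + 2 : ℕ) : ℝ) + 1 = -((n + 1 : ℕ) : ℝ) := by push_cast; ring
  rw [h3, Real.rpow_neg hz.le, Real.rpow_natCast]
  push_cast
  rw [neg_div_neg_eq, div_eq_mul_inv, mul_inv]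

/-! ### The Volterra iteration and its bounds -/

/-- `s ↦ s⁻² eˢ ∫ₛ^∞ e⁻ᵗ U(t) dt`, the derivative (up to sign) of the Volterra operator. -/
noncomputable def volterraKernel (U : ℝ → ℝ) (s : ℝ) : ℝ :=
  Real.exp s / s ^ 2 * ∫ t in Set.Ioi s, Real.exp (-t) * U t

/-- Iterates of the Volterra operator attached to `(z² e⁻ᶻ u')' = ε e⁻ᶻ u`, started at `1`. -/
noncomputable def volterraIter : ℕ → ℝ → ℝ
  | 0 => fun _ => 1
  | n + 1 => fun z => ∫ s in Set.Ioi z, volterraKernel (volterraIter n) s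

section Step

variable {U : ℝ → ℝ} {n : ℕ}

theorem integrableOn_exp_neg_mul (hc : ContinuousOn U (Set.Ioi 0))
    (hb : ∀ z, 0 < z → 0 ≤ U z ∧ U z ≤ (z ^ n * n.factorial)⁻¹) {a : ℝ} (ha : 0 < a) :
    IntegrableOn (fun t => Real.exp (-t) * U t) (Set.Ioi a) := by
  have h1 : IntegrableOn (fun t => Real.exp (-t) * (a ^ n * n.factorial : ℝ)⁻¹) (Set.Ioi a) :=
    (integrableOn_exp_neg_Ioi a).mul_const _
  refine Integrable.mono' h1 ?_ ?_
  · refine ContinuousOn.aestronglyMeasurable ?_ measurableSet_Ioi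
    exact (by fun_prop : Continuous fun t : ℝ => Real.exp (-t)).continuousOn.mul
      (hc.mono (Set.Ioi_subset_Ioi ha.le))
  · refine (ae_restrict_mem measurableSet_Ioi).mono fun t ht => ?_
    have hat : a < t := ht
    have ht0 : 0 < t := ha.trans hat
    obtain ⟨h0, h1⟩ := hb t ht0
    rw [Real.norm_of_nonneg (mul_nonneg (Real.exp_pos _).le h0)]
    gcongr
    refine h1.trans ?_
    gcongr

theorem hasDerivAt_volterraKernel (hc : ContinuousOn U (Set.Ioi 0))
    (hb : ∀ z, 0 < z → 0 ≤ U z ∧ U z ≤ (z ^ n * n.factorial)⁻¹) {z : ℝ} (hz : 0 < z) :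
    HasDerivAt (volterraKernel U) ((1 - 2 / z) * volterraKernel U z - (z ^ 2)⁻¹ * U z) z := by
  have h1 := hasDerivAt_integral_Ioi (h := fun t => Real.exp (-t) * U t) hz
    ((by fun_prop : Continuous fun t : ℝ => Real.exp (-t)).continuousOn.mul hc)
    (fun a ha => integrableOn_exp_neg_mul hc hb ha)
  have h2 := ((Real.hasDerivAt_exp z).div (hasDerivAt_pow 2 z) (by positivity)).mul h1
  refine h2.congr_deriv ?_
  simp only [volterraKernel, Pi.div_apply, Real.exp_neg]
  have := (Real.exp_pos z).ne'
  push_cast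
  field_simp
  ring

/-- For `t ≥ z` the bound on `U` is largest at `t = z`, so it leaves the integral; the remaining `∫
e⁻ᵗ = e⁻ᶻ` cancels the prefactor `eᶻ`. -/
theorem volterraKernel_bounds (hc : ContinuousOn U (Set.Ioi 0))
    (hb : ∀ z, 0 < z → 0 ≤ U z ∧ U z ≤ (z ^ n * n.factorial)⁻¹) {z : ℝ} (hz : 0 < z) :
    0 ≤ volterraKernel U z ∧ volterraKernel U z ≤ (z ^ (n + 2))⁻¹ * (n.factorial : ℝ)⁻¹ := by
  have h0 : 0 ≤ ∫ t in Set.Ioi z, Real.exp (-t) * U t :=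
    setIntegral_nonneg measurableSet_Ioi fun t ht =>
      mul_nonneg (Real.exp_pos _).le (hb t (hz.trans ht)).1
  have h1 : ∫ t in Set.Ioi z, Real.exp (-t) * U t
      ≤ ∫ t in Set.Ioi z, Real.exp (-t) * (z ^ n * n.factorial : ℝ)⁻¹ := by
    refine setIntegral_mono_on (integrableOn_exp_neg_mul hc hb hz)
      ((integrableOn_exp_neg_Ioi z).mul_const _) measurableSet_Ioi fun t ht => ?_
    have hzt : z < t := ht
    have := (hb t (hz.trans hzt)).2
    gcongr
    refine this.trans ?_
    gcongr
  rw [integral_mul_const, integral_exp_neg_Ioi] at h1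
  refine ⟨mul_nonneg (by positivity) h0, ?_⟩
  calc volterraKernel U z ≤ Real.exp z / z ^ 2 * (Real.exp (-z) * (z ^ n * n.factorial : ℝ)⁻¹) := by
        unfold volterraKernel; gcongr
    _ = _ := by
        rw [Real.exp_neg]
        have := (Real.exp_pos z).ne'
        field_simp
        ring

theorem integrableOn_volterraKernel (hc : ContinuousOn U (Set.Ioi 0))
    (hb : ∀ z, 0 < z → 0 ≤ U z ∧ U z ≤ (z ^ n * n.factorial)⁻¹) {a : ℝ} (ha : 0 < a) :
    IntegrableOn (volterraKernel U) (Set.Ioi a) := by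
  refine Integrable.mono' ((integrableOn_Ioi_inv_pow n ha).mul_const (n.factorial : ℝ)⁻¹) ?_ ?_
  · refine ContinuousOn.aestronglyMeasurable (fun t ht => ?_) measurableSet_Ioi
    exact (hasDerivAt_volterraKernel hc hb (ha.trans ht)).continuousAt.continuousWithinAt
  · refine (ae_restrict_mem measurableSet_Ioi).mono fun t ht => ?_
    obtain ⟨h0, h1⟩ := volterraKernel_bounds hc hb (ha.trans ht)
    rwa [Real.norm_of_nonneg h0]

end Step

/-- The factorial comes from the outer integration: integrating `s^{-(n+2)}/n!` over `(z, ∞)`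
produces the new factor `1/(n+1)`. Continuity joins the induction because integrability of the next
kernel needs it. -/
theorem volterraIter_continuousOn_and_bounds (n : ℕ) :
    ContinuousOn (volterraIter n) (Set.Ioi 0) ∧
      ∀ z, 0 < z → 0 ≤ volterraIter n z ∧ volterraIter n z ≤ (z ^ n * n.factorial)⁻¹ := by
  induction n with
  | zero => exact ⟨continuousOn_const, fun z _ => by simp [volterraIter]⟩
  | succ n ih =>
    obtain ⟨hc, hb⟩ := ih
    have hK : ContinuousOn (volterraKernel (volterraIter n)) (Set.Ioi 0) := fun t ht =>
      (hasDerivAt_volterraKernel hc hb ht).continuousAt.continuousWithinAt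
    refine ⟨fun z hz => ?_, fun z hz => ⟨?_, ?_⟩⟩
    · exact (hasDerivAt_integral_Ioi hz hK
        fun a ha => integrableOn_volterraKernel hc hb ha).continuousAt.continuousWithinAt
    · exact setIntegral_nonneg measurableSet_Ioi fun t ht =>
        (volterraKernel_bounds hc hb (hz.trans ht)).1
    · have h1 : volterraIter (n + 1) z
          ≤ ∫ s in Set.Ioi z, (s ^ (n + 2))⁻¹ * (n.factorial : ℝ)⁻¹ :=
        setIntegral_mono_on (integrableOn_volterraKernel hc hb hz)
          ((integrableOn_Ioi_inv_pow n hz).mul_const _) measurableSet_Ioi fun t ht =>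
          (volterraKernel_bounds hc hb (hz.trans ht)).2
      rw [integral_mul_const, integral_Ioi_inv_pow n hz] at h1
      refine h1.trans (le_of_eq ?_)
      rw [Nat.factorial_succ]
      push_cast
      rw [← mul_inv, mul_assoc]

theorem hasDerivAt_volterraIter_succ (n : ℕ) {z : ℝ} (hz : 0 < z) :
    HasDerivAt (volterraIter (n + 1)) (-volterraKernel (volterraIter n) z) z := by
  obtain ⟨hc, hb⟩ := volterraIter_continuousOn_and_bounds n
  exact hasDerivAt_integral_Ioi hz
    (fun t ht => (hasDerivAt_volterraKernel hc hb ht).continuousAt.continuousWithinAt)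
    fun a ha => integrableOn_volterraKernel hc hb ha

theorem abs_volterraIter_le (n : ℕ) {z : ℝ} (hz : 0 < z) :
    |volterraIter n z| ≤ (z⁻¹) ^ n / n.factorial := by
  obtain ⟨h0, h1⟩ := (volterraIter_continuousOn_and_bounds n).2 z hz
  rw [abs_of_nonneg h0, inv_pow, div_eq_mul_inv, ← mul_inv]
  exact h1

/-- The next iterate is determined by derivatives and limits at infinity. -/
theorem volterraIter_succ_eq {n : ℕ} {V F P : ℝ → ℝ} (hV : ∀ z, 0 < z → volterraIter n z = V z)
    (hP : ∀ z, 0 < z → HasDerivAt P (-(Real.exp (-z) * V z)) z)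
    (hF : ∀ z, 0 < z → HasDerivAt F (-(Real.exp z / z ^ 2 * P z)) z)
    (hP0 : Tendsto P atTop (𝓝 0)) (hF0 : Tendsto F atTop (𝓝 0)) {z : ℝ} (hz : 0 < z) :
    volterraIter (n + 1) z = F z := by
  obtain ⟨hc, hb⟩ := volterraIter_continuousOn_and_bounds n
  have hI : ∀ s, 0 < s → ∫ t in Set.Ioi s, Real.exp (-t) * volterraIter n t = P s := by
    intro s hs
    have h := integral_Ioi_of_hasDerivAt_of_tendsto' (a := s)
      (f' := fun t => -(Real.exp (-t) * volterraIter n t))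
      (fun t ht => by
        have ht0 : 0 < t := hs.trans_le ht
        simpa only [hV t ht0] using hP t ht0)
      (integrableOn_exp_neg_mul hc hb hs).neg hP0
    rw [integral_neg] at h
    linarith
  have h := integral_Ioi_of_hasDerivAt_of_tendsto' (a := z)
    (f' := fun t => -(volterraKernel (volterraIter n) t))
    (fun t ht => by
      have ht0 : 0 < t := hz.trans_le ht
      simp only [volterraKernel, hI t ht0]
      exact hF t ht0)
    (integrableOn_volterraKernel hc hb hz).neg hF0
  rw [integral_neg] at h
  show ∫ s in Set.Ioi z, volterraKernel (volterraIter n) s = F z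
  linarith

/-! ### The series solution -/

/-- The power series in `ε` solving `(z² e⁻ᶻ u')' = ε e⁻ᶻ u`, `u(∞) = 1`. -/
noncomputable def volterraSol (ε z : ℝ) : ℝ := ∑' n, ε ^ n * volterraIter n z

/-- The derivative of `volterraSol ε`. -/
noncomputable def volterraSolDeriv (ε z : ℝ) : ℝ :=
  ∑' n, ε ^ (n + 1) * -volterraKernel (volterraIter n) z

theorem norm_pow_mul_volterraIter_le (ε : ℝ) (n : ℕ) {z : ℝ} (hz : 0 < z) :
    ‖ε ^ n * volterraIter n z‖ ≤ (|ε| / z) ^ n / n.factorial := by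
  rw [norm_mul, norm_pow, Real.norm_eq_abs, Real.norm_eq_abs, div_pow, div_div,
    mul_comm (z ^ n)]
  calc _ ≤ |ε| ^ n * ((z⁻¹) ^ n / n.factorial) := by gcongr; exact abs_volterraIter_le n hz
    _ = _ := by rw [inv_pow]; field_simp

theorem summable_volterraIter (ε : ℝ) {z : ℝ} (hz : 0 < z) :
    Summable fun n => ε ^ n * volterraIter n z :=
  .of_norm_bounded (Real.summable_pow_div_factorial (|ε| / z))
    fun n => norm_pow_mul_volterraIter_le ε n hz

theorem abs_volterraKernel_le (n : ℕ) {z : ℝ} (hz : 0 < z) :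
    |volterraKernel (volterraIter n) z| ≤ (z ^ 2)⁻¹ * ((z⁻¹) ^ n / n.factorial) := by
  obtain ⟨hc, hb⟩ := volterraIter_continuousOn_and_bounds n
  obtain ⟨h0, h1⟩ := volterraKernel_bounds hc hb hz
  rw [abs_of_nonneg h0]
  refine h1.trans (le_of_eq ?_)
  rw [pow_add, mul_inv, inv_pow]
  ring

theorem norm_pow_mul_volterraKernel_le (ε : ℝ) (n : ℕ) {a z : ℝ} (ha : 0 < a) (haz : a ≤ z) :
    ‖ε ^ (n + 1) * -volterraKernel (volterraIter n) z‖
      ≤ |ε| * (a ^ 2)⁻¹ * ((|ε| / a) ^ n / n.factorial) := by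
  rw [norm_mul, norm_neg, norm_pow, Real.norm_eq_abs, Real.norm_eq_abs]
  calc _ ≤ |ε| ^ (n + 1) * ((z ^ 2)⁻¹ * ((z⁻¹) ^ n / n.factorial)) := by
        gcongr; exact abs_volterraKernel_le n (ha.trans_le haz)
    _ ≤ |ε| ^ (n + 1) * ((a ^ 2)⁻¹ * ((a⁻¹) ^ n / n.factorial)) := by
        have : z⁻¹ ≤ a⁻¹ := by gcongr
        have h2 : 0 ≤ z⁻¹ := inv_nonneg.2 (ha.le.trans haz)
        gcongr
    _ = _ := by rw [div_eq_mul_inv |ε|, mul_pow]; ring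

theorem hasDerivAt_volterraSol (ε : ℝ) {z : ℝ} (hz : 0 < z) :
    HasDerivAt (volterraSol ε) (volterraSolDeriv ε z) z := by
  have ha : 0 < z / 2 := by positivity
  have key : HasDerivAt (fun y => ∑' n, ε ^ (n + 1) * volterraIter (n + 1) y)
      (volterraSolDeriv ε z) z := by
    refine hasDerivAt_tsum_of_isPreconnected
      (g := fun n y => ε ^ (n + 1) * volterraIter (n + 1) y)
      (g' := fun n y => ε ^ (n + 1) * -volterraKernel (volterraIter n) y)
      (u := fun n => |ε| * ((z / 2) ^ 2)⁻¹ * ((|ε| / (z / 2)) ^ n / n.factorial))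
      (t := Set.Ioi (z / 2)) (y₀ := z)
      ((Real.summable_pow_div_factorial _).mul_left _) isOpen_Ioi isPreconnected_Ioi
      (fun n y hy => (hasDerivAt_volterraIter_succ n (ha.trans hy)).const_mul _)
      (fun n y hy => norm_pow_mul_volterraKernel_le ε n ha (le_of_lt hy)) ?_ ?_ ?_
    · exact half_lt_self hz
    · exact (summable_nat_add_iff (f := fun n => ε ^ n * volterraIter n z) 1).2
        (summable_volterraIter ε hz)
    · exact half_lt_self hz
  refine (key.const_add 1).congr_of_eventuallyEq ?_
  filter_upwards [Ioi_mem_nhds hz] with y hy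
  simp only [volterraSol]
  -- The zeroth iterate is constant, which is why the derivative series starts with `ε¹`.
  rw [(summable_volterraIter ε hy).tsum_eq_zero_add]
  simp [volterraIter]

theorem hasDerivAt_volterraSolDeriv (ε : ℝ) {z : ℝ} (hz : 0 < z) :
    HasDerivAt (volterraSolDeriv ε)
      ((1 - 2 / z) * volterraSolDeriv ε z + ε * (z ^ 2)⁻¹ * volterraSol ε z) z := by
  have ha : 0 < z / 2 := by positivity
  have hsK : ∀ y, 0 < y → Summable fun n => ε ^ (n + 1) * -volterraKernel (volterraIter n) y :=
    fun y hy => .of_norm_bounded ((Real.summable_pow_div_factorial (|ε| / y)).mul_left _)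
      fun n => norm_pow_mul_volterraKernel_le ε n hy le_rfl
  have key : HasDerivAt (volterraSolDeriv ε) (∑' n, ε ^ (n + 1) *
      -((1 - 2 / z) * volterraKernel (volterraIter n) z - (z ^ 2)⁻¹ * volterraIter n z)) z := by
    refine hasDerivAt_tsum_of_isPreconnected
      (g := fun n y => ε ^ (n + 1) * -volterraKernel (volterraIter n) y)
      (g' := fun n y => ε ^ (n + 1) *
        -((1 - 2 / y) * volterraKernel (volterraIter n) y - (y ^ 2)⁻¹ * volterraIter n y))
      (u := fun n => (1 + 2 / (z / 2)) * (|ε| * ((z / 2) ^ 2)⁻¹ *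
          ((|ε| / (z / 2)) ^ n / n.factorial)) +
        |ε| * ((z / 2) ^ 2)⁻¹ * ((|ε| / (z / 2)) ^ n / n.factorial))
      (t := Set.Ioi (z / 2)) (y₀ := z)
      ((((Real.summable_pow_div_factorial _).mul_left _).mul_left _).add
        ((Real.summable_pow_div_factorial _).mul_left _)) isOpen_Ioi isPreconnected_Ioi
      (fun n y hy => ?_) (fun n y hy => ?_) ?_ (hsK z hz) ?_
    · obtain ⟨hc, hb⟩ := volterraIter_continuousOn_and_bounds n
      exact ((hasDerivAt_volterraKernel hc hb (ha.trans hy)).neg).const_mul _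
    · have hzy : z / 2 < y := hy
      have hy0 : 0 < y := ha.trans hzy
      -- Each termwise derivative is a combination of the `n`-th terms of `u'` and `u`, with
      -- coefficients bounded on `(z/2, ∞)`. The exponential majorants apply to both, and summing
      -- gives the differential equation.
      have e : ε ^ (n + 1) *
          -((1 - 2 / y) * volterraKernel (volterraIter n) y - (y ^ 2)⁻¹ * volterraIter n y) =
          (1 - 2 / y) * (ε ^ (n + 1) * -volterraKernel (volterraIter n) y) +
          ε * (y ^ 2)⁻¹ * (ε ^ n * volterraIter n y) := by ring
      rw [e]
      refine (norm_add_le _ _).trans (add_le_add ?_ ?_)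
      · rw [norm_mul]
        gcongr
        · refine (norm_sub_le _ _).trans ?_
          rw [norm_one, Real.norm_of_nonneg (by positivity)]
          gcongr
        · exact norm_pow_mul_volterraKernel_le ε n ha hzy.le
      · rw [norm_mul, norm_mul, Real.norm_eq_abs, Real.norm_of_nonneg (by positivity)]
        gcongr
        refine (norm_pow_mul_volterraIter_le ε n hy0).trans ?_
        gcongr
    · exact half_lt_self hz
    · exact half_lt_self hz
  refine key.congr_deriv ?_
  unfold volterraSolDeriv volterraSol
  rw [← tsum_mul_left, ← tsum_mul_left,
    ← ((hsK z hz).mul_left _).tsum_add ((summable_volterraIter ε hz).mul_left _)]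
  exact tsum_congr fun n => by ring

/-- Since `(n + k)! ≥ n!`, the tail is dominated by `(|ε|/z)^k` times the full exponential series.
-/
theorem abs_volterraSol_sub_le (ε : ℝ) (k : ℕ) {z : ℝ} (hz : 0 < z) :
    |volterraSol ε z - ∑ n ∈ Finset.range k, ε ^ n * volterraIter n z|
      ≤ (|ε| / z) ^ k * Real.exp (|ε| / z) := by
  have hs := summable_volterraIter ε hz
  have h1 : volterraSol ε z - ∑ n ∈ Finset.range k, ε ^ n * volterraIter n z =
      ∑' n, ε ^ (n + k) * volterraIter (n + k) z := by
    rw [volterraSol, ← hs.sum_add_tsum_nat_add k]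
    ring
  have h2 : HasSum (fun n : ℕ => (|ε| / z) ^ k * ((|ε| / z) ^ n / n.factorial))
      ((|ε| / z) ^ k * Real.exp (|ε| / z)) := by
    rw [Real.exp_eq_exp_ℝ]
    exact (NormedSpace.exp_series_hasSum_exp' (𝕂 := ℝ) (|ε| / z)).mul_left _ |>.congr_fun
      fun n => by simp [div_eq_inv_mul]
  rw [h1, ← Real.norm_eq_abs]
  refine tsum_of_norm_bounded h2 fun n => (norm_pow_mul_volterraIter_le ε (n + k) hz).trans ?_
  rw [pow_add, mul_comm ((|ε| / z) ^ n), mul_div_assoc]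
  gcongr
  omega

/-! ### The exponential integral and its tail integral -/

theorem integrableOn_exp_neg_div {a : ℝ} (ha : 0 < a) :
    IntegrableOn (fun y => Real.exp (-y) / y) (Set.Ioi a) := by
  refine Integrable.mono' ((integrableOn_exp_neg_Ioi a).mul_const a⁻¹) ?_ ?_
  · refine ContinuousOn.aestronglyMeasurable (fun t ht => ?_) measurableSet_Ioi
    have : t ≠ 0 := (ha.trans ht).ne'
    exact ContinuousAt.continuousWithinAt (by fun_prop (disch := assumption))
  · refine (ae_restrict_mem measurableSet_Ioi).mono fun t ht => ?_
    have hat : a < t := ht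
    have ht0 : 0 < t := ha.trans hat
    rw [Real.norm_of_nonneg (by positivity), div_eq_mul_inv]
    gcongr

theorem hasDerivAt_E1 {z : ℝ} (hz : 0 < z) : HasDerivAt E1 (-(Real.exp (-z) / z)) z := by
  refine hasDerivAt_integral_Ioi (h := fun y => Real.exp (-y) / y) hz (fun t ht => ?_)
    fun a ha => integrableOn_exp_neg_div ha
  have : t ≠ 0 := ne_of_gt ht
  exact ContinuousAt.continuousWithinAt (by fun_prop (disch := assumption))

theorem tendsto_E1_atTop : Tendsto E1 atTop (𝓝 0) := tendsto_integral_Ioi_zero tendsto_id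

/-- `eᶻ E₁(z)`. -/
noncomputable def expE1 (z : ℝ) : ℝ := Real.exp z * E1 z

theorem expE1_bounds {z : ℝ} (hz : 0 < z) : 0 ≤ expE1 z ∧ expE1 z ≤ z⁻¹ := by
  have h0 : 0 ≤ E1 z := setIntegral_nonneg measurableSet_Ioi fun t ht => by
    have : 0 < t := hz.trans ht
    positivity
  have h1 : E1 z ≤ ∫ t in Set.Ioi z, Real.exp (-t) * z⁻¹ := by
    refine setIntegral_mono_on (integrableOn_exp_neg_div hz)
      ((integrableOn_exp_neg_Ioi z).mul_const _) measurableSet_Ioi fun t ht => ?_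
    have hzt : z < t := ht
    rw [div_eq_mul_inv]
    gcongr
  rw [integral_mul_const, integral_exp_neg_Ioi] at h1
  refine ⟨mul_nonneg (Real.exp_pos _).le h0, ?_⟩
  calc expE1 z ≤ Real.exp z * (Real.exp (-z) * z⁻¹) := by unfold expE1; gcongr
    _ = z⁻¹ := by rw [← mul_assoc, ← Real.exp_add]; simp

theorem hasDerivAt_expE1 {z : ℝ} (hz : 0 < z) : HasDerivAt expE1 (expE1 z - z⁻¹) z := by
  refine ((Real.hasDerivAt_exp z).mul (hasDerivAt_E1 hz)).congr_deriv ?_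
  rw [Real.exp_neg, expE1]
  have := (Real.exp_pos z).ne'
  field_simp
  ring

theorem continuousOn_expE1 : ContinuousOn expE1 (Set.Ioi 0) := fun _ ht =>
  (hasDerivAt_expE1 ht).continuousAt.continuousWithinAt

/-- `∫_z^∞ eᵘ E₁(u) / u du`. -/
noncomputable def tailExpE1 (z : ℝ) : ℝ := ∫ u in Set.Ioi z, expE1 u / u

theorem continuousOn_expE1_div : ContinuousOn (fun u => expE1 u / u) (Set.Ioi 0) :=
  continuousOn_expE1.div continuousOn_id fun _ ht => ne_of_gt ht

theorem expE1_div_bounds {u : ℝ} (hu : 0 < u) :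
    0 ≤ expE1 u / u ∧ expE1 u / u ≤ (u ^ (0 + 2))⁻¹ := by
  obtain ⟨h0, h1⟩ := expE1_bounds hu
  refine ⟨by positivity, ?_⟩
  calc expE1 u / u ≤ u⁻¹ / u := by gcongr
    _ = _ := by field_simp

theorem integrableOn_expE1_div {a : ℝ} (ha : 0 < a) :
    IntegrableOn (fun u => expE1 u / u) (Set.Ioi a) := by
  refine Integrable.mono' (integrableOn_Ioi_inv_pow 0 ha) ?_ ?_
  · exact (continuousOn_expE1_div.mono (Set.Ioi_subset_Ioi ha.le)).aestronglyMeasurable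
      measurableSet_Ioi
  · refine (ae_restrict_mem measurableSet_Ioi).mono fun t ht => ?_
    obtain ⟨h0, h1⟩ := expE1_div_bounds (ha.trans ht)
    rwa [Real.norm_of_nonneg h0]

theorem hasDerivAt_tailExpE1 {z : ℝ} (hz : 0 < z) :
    HasDerivAt tailExpE1 (-(expE1 z / z)) z :=
  hasDerivAt_integral_Ioi hz continuousOn_expE1_div fun _ ha => integrableOn_expE1_div ha

theorem tailExpE1_bounds {z : ℝ} (hz : 0 < z) : 0 ≤ tailExpE1 z ∧ tailExpE1 z ≤ z⁻¹ := by
  refine ⟨setIntegral_nonneg measurableSet_Ioi fun t ht => (expE1_div_bounds (hz.trans ht)).1, ?_⟩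
  have h : tailExpE1 z ≤ ∫ u in Set.Ioi z, (u ^ (0 + 2))⁻¹ :=
    setIntegral_mono_on (integrableOn_expE1_div hz) (integrableOn_Ioi_inv_pow 0 hz)
      measurableSet_Ioi fun t ht => (expE1_div_bounds (hz.trans ht)).2
  rw [integral_Ioi_inv_pow 0 hz] at h
  simpa using h

theorem tendsto_zero_of_bounds {f : ℝ → ℝ} (hf : ∀ z, 0 < z → 0 ≤ f z ∧ f z ≤ z⁻¹) :
    Tendsto f atTop (𝓝 0) :=
  tendsto_of_tendsto_of_tendsto_of_le_of_le' tendsto_const_nhds tendsto_inv_atTop_zero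
    ((eventually_gt_atTop 0).mono fun z hz => (hf z hz).1)
    ((eventually_gt_atTop 0).mono fun z hz => (hf z hz).2)

/-- The function `L` with `G` replaced by its real integral representation. -/
noncomputable def realL (z : ℝ) : ℝ := expE1 z - 1 + z * tailExpE1 z

theorem hasDerivAt_realL {z : ℝ} (hz : 0 < z) :
    HasDerivAt realL (tailExpE1 z - z⁻¹) z := by
  refine (((hasDerivAt_expE1 hz).sub_const 1).add
    ((hasDerivAt_id z).mul (hasDerivAt_tailExpE1 hz))).congr_deriv ?_
  simp only [id]
  field_simp
  ring

/-! ### Closed forms of the first three iterates -/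

theorem tendsto_exp_neg_atTop : Tendsto (fun z : ℝ => Real.exp (-z)) atTop (𝓝 0) :=
  Real.tendsto_exp_atBot.comp tendsto_neg_atTop_atBot

theorem volterraIter_one {z : ℝ} (hz : 0 < z) : volterraIter 1 z = z⁻¹ := by
  refine volterraIter_succ_eq (V := fun _ => 1) (P := fun z => Real.exp (-z))
    (fun _ _ => rfl) (fun z _ => ?_) (fun z hz => ?_) tendsto_exp_neg_atTop
    tendsto_inv_atTop_zero hz
  · simpa using (hasDerivAt_neg z).exp
  · refine (hasDerivAt_inv hz.ne').congr_deriv ?_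
    rw [Real.exp_neg]
    have := (Real.exp_pos z).ne'
    field_simp

theorem tendsto_realL_div_atTop : Tendsto (fun z => realL z / z) atTop (𝓝 0) := by
  have h1 := tendsto_zero_of_bounds fun z hz => expE1_bounds hz
  have h2 := tendsto_zero_of_bounds fun z hz => tailExpE1_bounds hz
  have h := ((h1.sub_const 1).mul tendsto_inv_atTop_zero).add h2
  refine Tendsto.congr' ?_ (by simpa using h)
  filter_upwards [eventually_gt_atTop 0] with z hz
  rw [realL]
  field_simp

/-- The inner integral `∫ e⁻ᵗ/t` is `E1` itself; in the derivative of `realL z / z` the tail terms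
cancel and only `-expE1 z / z²` survives. -/
theorem volterraIter_two {z : ℝ} (hz : 0 < z) : volterraIter 2 z = realL z / z := by
  refine volterraIter_succ_eq (V := fun z => z⁻¹) (P := E1)
    (fun _ hz => volterraIter_one hz) (fun z hz => hasDerivAt_E1 hz) (fun z hz => ?_)
    tendsto_E1_atTop tendsto_realL_div_atTop hz
  refine ((hasDerivAt_realL hz).div (hasDerivAt_id z) hz.ne').congr_deriv ?_
  simp only [id, realL, expE1]
  field_simp
  ring

theorem volterraIter_three {z : ℝ} (hz : 0 < z) :
    volterraIter 3 z = (tailExpE1 z - 2 * realL z) / z := by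
  have h1 := tendsto_zero_of_bounds fun z hz => expE1_bounds hz
  have h2 := tendsto_zero_of_bounds fun z hz => tailExpE1_bounds hz
  refine volterraIter_succ_eq (V := fun z => realL z / z)
    -- An antiderivative of `-e⁻ᶻ L(z)/z`, using `L(z)/z = (expE1 z - 1)/z + tailExpE1 z`.
    (P := fun z => Real.exp (-z) * (tailExpE1 z - expE1 z))
    (F := fun z => (tailExpE1 z - 2 * realL z) / z)
    (fun _ hz => volterraIter_two hz) (fun z hz => ?_) (fun z hz => ?_) ?_ ?_ hz
  · refine ((hasDerivAt_neg z).exp.mul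
      ((hasDerivAt_tailExpE1 hz).sub (hasDerivAt_expE1 hz))).congr_deriv ?_
    simp only [realL, Pi.sub_apply]
    field_simp
    ring
  · refine (((hasDerivAt_tailExpE1 hz).sub ((hasDerivAt_realL hz).const_mul 2)).div
      (hasDerivAt_id z) hz.ne').congr_deriv ?_
    simp only [id, realL, Real.exp_neg, Pi.sub_apply]
    have := (Real.exp_pos z).ne'
    field_simp
    ring
  · simpa using tendsto_exp_neg_atTop.mul (h2.sub h1)
  · have h := (h2.mul tendsto_inv_atTop_zero).sub (tendsto_realL_div_atTop.const_mul 2)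
    refine Tendsto.congr (fun z => ?_) (by simpa using h)
    ring

/-! ### Mellin transforms -/

theorem HasMellin.congr_Ioi {f g : ℝ → ℂ} {s m : ℂ} (hf : HasMellin f s m)
    (h : ∀ z, 0 < z → f z = g z) : HasMellin g s m := by
  have e : Set.EqOn (fun t : ℝ => (t : ℂ) ^ (s - 1) • f t)
      (fun t : ℝ => (t : ℂ) ^ (s - 1) • g t) (Set.Ioi 0) := fun t ht => by
    simp only [h t ht]
  refine ⟨IntegrableOn.congr_fun hf.1 e measurableSet_Ioi, ?_⟩
  rw [← hf.2]
  exact (setIntegral_congr_fun measurableSet_Ioi e).symm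

/-- The Mellin transform of a multiplicative convolution is the product of Mellin transforms. -/
theorem hasMellin_mulConv {φ k : ℝ → ℂ} {s : ℂ} (hφc : ContinuousOn φ (Set.Ioi 0))
    (hkm : Measurable k) (hφ : MellinConvergent φ s) (hk : MellinConvergent k (1 - s)) :
    HasMellin (fun z => ∫ v in Set.Ioi (0 : ℝ), φ (z * v) * k v) s
      (mellin φ s * mellin k (1 - s)) := by
  set μ := (volume : Measure ℝ).restrict (Set.Ioi 0) with hμ
  let F : ℝ → ℝ → ℂ := fun z v => (z : ℂ) ^ (s - 1) * (φ (z * v) * k v)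
  have hmeas : AEStronglyMeasurable (Function.uncurry F) (μ.prod μ) := by
    have h1 : AEStronglyMeasurable (fun p : ℝ × ℝ => (p.1 : ℂ) ^ (s - 1) * φ (p.1 * p.2))
        (μ.prod μ) := by
      rw [hμ, Measure.prod_restrict]
      refine ContinuousOn.aestronglyMeasurable ?_ (measurableSet_Ioi.prod measurableSet_Ioi)
      refine ContinuousOn.mul (fun p hp => ?_) (hφc.comp (by fun_prop) fun p hp =>
        (mul_pos (Set.mem_Ioi.1 hp.1) (Set.mem_Ioi.1 hp.2) : 0 < p.1 * p.2))
      refine ContinuousAt.continuousWithinAt (ContinuousAt.cpow ?_ continuousAt_const ?_)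
      · exact (Complex.continuous_ofReal.comp continuous_fst).continuousAt
      · exact Complex.ofReal_mem_slitPlane.2 hp.1
    have h2 : AEStronglyMeasurable (fun p : ℝ × ℝ => k p.2) (μ.prod μ) :=
      (hkm.comp measurable_snd).aestronglyMeasurable
    refine (h1.mul h2).congr (ae_of_all _ fun p => ?_)
    simp [F, Function.uncurry, mul_assoc]
  -- Rescaling `z` by `v` factorises the norm of each slice, so the Fubini hypothesis reduces to the
  -- two Mellin convergences.
  have hnorm : ∀ v : ℝ, 0 < v → ∫ z, ‖F z v‖ ∂μ =
      (∫ z in Set.Ioi (0 : ℝ), ‖(z : ℂ) ^ (s - 1) • φ z‖) * ‖(v : ℂ) ^ (1 - s - 1) • k v‖ := by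
    intro v hv
    have e : ∀ z ∈ Set.Ioi (0 : ℝ), ‖F z v‖ = ‖(v : ℂ) ^ (1 - s)‖ * ‖k v‖ *
        (fun t : ℝ => ‖(t : ℂ) ^ (s - 1) • φ t‖) (v * z) := by
      intro z hz
      have hz : 0 < z := hz
      simp only [F, norm_mul, smul_eq_mul, mul_comm v z]
      rw [Complex.norm_cpow_eq_rpow_re_of_pos hz, Complex.norm_cpow_eq_rpow_re_of_pos hv,
        Complex.norm_cpow_eq_rpow_re_of_pos (mul_pos hz hv), Real.mul_rpow hz.le hv.le]
      have : v ^ (1 - s).re * v ^ (s - 1).re = 1 := by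
        rw [← Real.rpow_add hv]; simp
      linear_combination (-(z ^ (s - 1).re) * ‖φ (z * v)‖ * ‖k v‖) * this
    rw [setIntegral_congr_fun measurableSet_Ioi e, integral_const_mul,
      integral_comp_mul_left_Ioi (fun t : ℝ => ‖(t : ℂ) ^ (s - 1) • φ t‖) 0 hv, mul_zero,
      smul_eq_mul, norm_smul, Complex.norm_cpow_eq_rpow_re_of_pos hv,
      Complex.norm_cpow_eq_rpow_re_of_pos hv]
    have : v ^ (1 - s - 1).re = v ^ (1 - s).re * v⁻¹ := by
      rw [Complex.sub_re, Real.rpow_sub hv]; simp [div_eq_mul_inv]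
    rw [this]
    ring
  have hint : Integrable (Function.uncurry F) (μ.prod μ) := by
    rw [integrable_prod_iff' hmeas]
    constructor
    · refine (ae_restrict_mem measurableSet_Ioi).mono fun v hv => ?_
      have h := ((MellinConvergent.comp_mul_left hv).2 hφ).mul_const (k v)
      refine h.congr (ae_of_all _ fun z => ?_)
      simp [F, Function.uncurry, mul_comm z v, mul_assoc]
    · refine Integrable.congr (hk.norm.const_mul
        (∫ z in Set.Ioi (0 : ℝ), ‖(z : ℂ) ^ (s - 1) • φ z‖)) ?_
      exact (ae_restrict_mem measurableSet_Ioi).mono fun v hv => (hnorm v hv).symm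
  have hpull : ∀ z : ℝ, ∫ v, F z v ∂μ = (z : ℂ) ^ (s - 1) • ∫ v in Set.Ioi 0, φ (z * v) * k v :=
    fun z => integral_const_mul _ _
  refine ⟨?_, ?_⟩
  · exact (hint.integral_prod_left).congr (ae_of_all _ hpull)
  · calc mellin (fun z => ∫ v in Set.Ioi (0 : ℝ), φ (z * v) * k v) s
        = ∫ z, ∫ v, F z v ∂μ ∂μ := integral_congr_ae (ae_of_all _ fun z => (hpull z).symm)
      _ = ∫ v, ∫ z, F z v ∂μ ∂μ := integral_integral_swap hint
      _ = ∫ v in Set.Ioi (0 : ℝ), mellin φ s * ((v : ℂ) ^ (1 - s - 1) • k v) := by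
        refine setIntegral_congr_fun measurableSet_Ioi fun v hv => ?_
        have h := mellin_comp_mul_left φ s hv
        have e : ∫ z, F z v ∂μ = mellin (fun t => φ (v * t)) s * k v := by
          rw [mellin, ← integral_mul_const]
          refine integral_congr_ae (ae_of_all _ fun z => ?_)
          simp [F, mul_comm z v, mul_assoc]
        simp only [e, h, smul_eq_mul]
        rw [show 1 - s - 1 = -s by ring]
        ring
      _ = _ := integral_const_mul _ _

theorem hasMellin_exp_neg {s : ℂ} (hs : 0 < s.re) :
    HasMellin (fun t : ℝ => (Real.exp (-t) : ℂ)) s (Complex.Gamma s) := by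
  refine ⟨?_, ?_⟩
  · refine IntegrableOn.congr_fun (Complex.GammaIntegral_convergent hs) (fun t _ => ?_)
      measurableSet_Ioi
    simp [mul_comm]
  · rw [Complex.Gamma_eq_integral hs, Complex.GammaIntegral_eq_mellin]

/-- `1/(1+z) = ∫₀^∞ e^{-zv} e^{-v} dv` is a multiplicative convolution of two exponentials. -/
theorem hasMellin_inv_one_add {s : ℂ} (hs : 0 < s.re) (hs1 : s.re < 1) :
    HasMellin (fun t : ℝ => ((1 + t)⁻¹ : ℂ)) s (Complex.Gamma s * Complex.Gamma (1 - s)) := by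
  have h1 := hasMellin_exp_neg hs
  have h2 := hasMellin_exp_neg (s := 1 - s) (by simpa using hs1)
  have h := hasMellin_mulConv (by fun_prop) (by fun_prop) h1.1 h2.1
  rw [h1.2, h2.2] at h
  refine h.congr_Ioi fun z hz => ?_
  have e : ∀ v : ℝ, (Real.exp (-(z * v)) : ℂ) * (Real.exp (-v) : ℂ) =
      ((Real.exp (-(1 + z) * v) : ℝ) : ℂ) := fun v => by
    rw [← Complex.ofReal_mul, ← Real.exp_add]
    congr 2
    ring
  simp only [e]
  rw [integral_complex_ofReal, integral_exp_mul_Ioi (by linarith) 0]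
  rw [mul_zero, Real.exp_zero, neg_div_neg_eq, one_div]
  push_cast
  rfl

/-- Substitute `y = z(1 + v)` in `E1`. The result is again a multiplicative convolution. -/
theorem expE1_eq_integral {z : ℝ} (hz : 0 < z) :
    expE1 z = ∫ v in Set.Ioi (0 : ℝ), Real.exp (-(z * v)) * (1 + v)⁻¹ := by
  have h1 := integral_comp_mul_left_Ioi (fun y => Real.exp (-y) / y) 1 hz
  have h2 := (measurePreserving_add_right volume (1 : ℝ)).setIntegral_preimage_emb
    (measurableEmbedding_addRight 1) (fun v => Real.exp (-(z * v)) / (z * v)) (Set.Ioi 1)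
  rw [h1, mul_one, smul_eq_mul] at h2
  have h3 : (fun x : ℝ => x + 1) ⁻¹' Set.Ioi 1 = Set.Ioi 0 := by ext; simp
  rw [h3] at h2
  have h4 : E1 z = z * ∫ v in Set.Ioi (0 : ℝ), Real.exp (-(z * (v + 1))) / (z * (v + 1)) := by
    rw [h2, ← mul_assoc, mul_inv_cancel₀ hz.ne', one_mul, E1]
  rw [expE1, h4, ← mul_assoc, ← integral_const_mul]
  refine setIntegral_congr_fun measurableSet_Ioi fun v hv => ?_
  have hv : 0 < v := hv
  have e : Real.exp (-(z * (v + 1))) = Real.exp (-(z * v)) * (Real.exp z)⁻¹ := by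
    rw [← Real.exp_neg, ← Real.exp_add]; ring_nf
  have := (Real.exp_pos z).ne'
  have : v + 1 ≠ 0 := by positivity
  simp only [e, add_comm 1 v]
  field_simp

theorem hasMellin_expE1 {s : ℂ} (hs : 0 < s.re) (hs1 : s.re < 1) :
    HasMellin (fun z : ℝ => (expE1 z : ℂ)) s
      (Complex.Gamma s * (Complex.Gamma (1 - s) * Complex.Gamma s)) := by
  have h1 := hasMellin_exp_neg hs
  have h2 := hasMellin_inv_one_add (s := 1 - s) (by simpa using hs1) (by simpa using hs)
  have h := hasMellin_mulConv (by fun_prop) (by fun_prop) h1.1 h2.1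
  rw [h1.2, h2.2, sub_sub_cancel] at h
  refine h.congr_Ioi fun z hz => ?_
  rw [expE1_eq_integral hz, ← integral_complex_ofReal]
  push_cast
  rfl

/-- Convolving with this cutoff turns `f` into `∫_z^∞ f(u)/u du`, so that tail integral divides the
Mellin transform by `s`. -/
theorem hasMellin_indicator_inv {s : ℂ} (hs : 0 < s.re) :
    HasMellin (Set.indicator (Set.Ioi (1 : ℝ)) fun v : ℝ => ((v⁻¹ : ℝ) : ℂ)) (1 - s) (1 / s) := by
  have e : Set.EqOn (fun t : ℝ => (t : ℂ) ^ (1 - s - 1) •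
      Set.indicator (Set.Ioi (1 : ℝ)) (fun v : ℝ => ((v⁻¹ : ℝ) : ℂ)) t)
      (Set.indicator (Set.Ioi (1 : ℝ)) fun t : ℝ => (t : ℂ) ^ (-s - 1)) (Set.Ioi 0) := by
    intro t ht
    have ht : (t : ℂ) ≠ 0 := Complex.ofReal_ne_zero.2 (ne_of_gt ht)
    by_cases h : t ∈ Set.Ioi (1 : ℝ)
    · simp only [Set.indicator_of_mem h, smul_eq_mul]
      rw [show 1 - s - 1 = -s by ring, Complex.cpow_sub _ _ ht, Complex.cpow_one,
        Complex.ofReal_inv, div_eq_mul_inv]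
    · simp [Set.indicator_of_notMem h]
  have hre : (-s - 1).re < -1 := by simp; linarith
  have hi := integrableOn_Ioi_cpow_of_lt hre one_pos
  refine ⟨?_, ?_⟩
  · refine IntegrableOn.congr_fun ?_ e.symm measurableSet_Ioi
    exact (hi.integrable_indicator measurableSet_Ioi).integrableOn
  · rw [mellin, setIntegral_congr_fun measurableSet_Ioi e, setIntegral_indicator measurableSet_Ioi,
      show Set.Ioi (0 : ℝ) ∩ Set.Ioi 1 = Set.Ioi 1 by ext x; simp,
      integral_Ioi_cpow_of_lt hre one_pos]
    simp

theorem tailExpE1_eq_integral {z : ℝ} (hz : 0 < z) :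
    (tailExpE1 z : ℂ) = ∫ v in Set.Ioi (0 : ℝ), (expE1 (z * v) : ℂ) *
      Set.indicator (Set.Ioi (1 : ℝ)) (fun v : ℝ => ((v⁻¹ : ℝ) : ℂ)) v := by
  have e : (fun v : ℝ => (expE1 (z * v) : ℂ) *
      Set.indicator (Set.Ioi (1 : ℝ)) (fun v : ℝ => ((v⁻¹ : ℝ) : ℂ)) v) =
      Set.indicator (Set.Ioi (1 : ℝ)) fun v : ℝ => ((z * (expE1 (z * v) / (z * v)) : ℝ) : ℂ) := by
    ext v
    by_cases h : v ∈ Set.Ioi (1 : ℝ)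
    · simp only [Set.indicator_of_mem h]
      push_cast
      have : (z : ℂ) ≠ 0 := Complex.ofReal_ne_zero.2 hz.ne'
      field_simp
    · simp [Set.indicator_of_notMem h]
  rw [e, setIntegral_indicator measurableSet_Ioi,
    show Set.Ioi (0 : ℝ) ∩ Set.Ioi 1 = Set.Ioi 1 by ext x; simp,
    integral_complex_ofReal, integral_const_mul,
    integral_comp_mul_left_Ioi (fun u => expE1 u / u) 1 hz, mul_one, smul_eq_mul, ← mul_assoc,
    mul_inv_cancel₀ hz.ne', one_mul, tailExpE1]

theorem hasMellin_tailExpE1 {s : ℂ} (hs : 0 < s.re) (hs1 : s.re < 1) :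
    HasMellin (fun z : ℝ => (tailExpE1 z : ℂ)) s
      (Complex.Gamma s * (Complex.Gamma (1 - s) * Complex.Gamma s) * (1 / s)) := by
  have h1 := hasMellin_expE1 hs hs1
  have h2 := hasMellin_indicator_inv hs
  have hm : Measurable (Set.indicator (Set.Ioi (1 : ℝ)) fun v : ℝ => ((v⁻¹ : ℝ) : ℂ)) :=
    Measurable.indicator (by fun_prop) measurableSet_Ioi
  have h := hasMellin_mulConv (φ := fun z : ℝ => (expE1 z : ℂ))
    (Complex.continuous_ofReal.comp_continuousOn continuousOn_expE1) hm h1.1 h2.1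
  rw [h1.2, h2.2] at h
  exact h.congr_Ioi fun z hz => (tailExpE1_eq_integral hz).symm

/-! ### Vertical decay and the Meijer function -/

theorem norm_Gamma_le {s : ℂ} (hs : 0 < s.re) : ‖Complex.Gamma s‖ ≤ Real.Gamma s.re := by
  rw [Complex.Gamma_eq_integral hs, Real.Gamma_eq_integral hs, Complex.GammaIntegral]
  refine (norm_integral_le_integral_norm _).trans (le_of_eq ?_)
  refine setIntegral_congr_fun measurableSet_Ioi fun x hx => ?_
  simp only [norm_mul, Complex.norm_real, Complex.norm_cpow_eq_rpow_re_of_pos hx]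
  simp [abs_of_pos (Real.exp_pos _)]

theorem one_add_sq_div_four_le_cosh (x : ℝ) : 1 + x ^ 2 / 4 ≤ Real.cosh x := by
  wlog hx : 0 ≤ x generalizing x
  · simpa using this (-x) (by linarith)
  rw [Real.cosh_eq]
  have h1 := Real.quadratic_le_exp_of_nonneg hx
  have h2 := Real.add_one_le_exp (-x)
  linarith

theorem abs_sin_re_mul_cosh_im_le_norm_sin (z : ℂ) :
    |Real.sin z.re| * Real.cosh z.im ≤ ‖Complex.sin z‖ := by
  have h : (Complex.sin z).re = Real.sin z.re * Real.cosh z.im := by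
    rw [Complex.sin_eq, ← Complex.ofReal_sin, ← Complex.ofReal_cosh, ← Complex.ofReal_cos,
      ← Complex.ofReal_sinh]
    simp only [Complex.add_re, Complex.mul_re, Complex.mul_im, Complex.ofReal_re,
      Complex.ofReal_im, Complex.I_re, Complex.I_im]
    ring
  have h2 := Complex.abs_re_le_norm (Complex.sin z)
  rwa [h, abs_mul, abs_of_pos (Real.cosh_pos _)] at h2

/-- By reflection `Γ(s) Γ(1-s) = π / sin(πs)`. The other factors `Γ(s)` and `1/s` are bounded on the
line, and the sine grows at least like `1 + y²`. -/
theorem verticalIntegrable_mellin_tailExpE1 {c : ℝ} (hc : 0 < c) (hc1 : c < 1) :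
    Complex.VerticalIntegrable (mellin fun z : ℝ => (tailExpE1 z : ℂ)) c := by
  have hm : ∀ y : ℝ, mellin (fun z : ℝ => (tailExpE1 z : ℂ)) (c + y * Complex.I) =
      Complex.Gamma (c + y * Complex.I) * (Real.pi / Complex.sin (Real.pi * (c + y * Complex.I))) *
        (1 / (c + y * Complex.I)) := fun y => by
    rw [(hasMellin_tailExpE1 (s := c + y * Complex.I) (by simpa) (by simpa)).2,
      ← Complex.Gamma_mul_Gamma_one_sub]
    ring
  have hsin : 0 < Real.sin (Real.pi * c) := Real.sin_pos_of_pos_of_lt_pi (by positivity)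
    (by nlinarith [Real.pi_pos])
  have hsn : ∀ y : ℝ, Real.sin (Real.pi * c) * (1 + y ^ 2) ≤
      ‖Complex.sin (Real.pi * (c + y * Complex.I))‖ := fun y => by
    refine le_trans ?_ (abs_sin_re_mul_cosh_im_le_norm_sin _)
    have h1 : (Real.pi * (c + y * Complex.I) : ℂ).re = Real.pi * c := by simp
    have h2 : (Real.pi * (c + y * Complex.I) : ℂ).im = Real.pi * y := by simp
    rw [h1, h2, abs_of_pos hsin]
    gcongr
    refine le_trans ?_ (one_add_sq_div_four_le_cosh _)
    -- `π² ≥ 9 > 4` absorbs the factor `1/4` of the cosh bound.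
    nlinarith [Real.pi_gt_three, sq_nonneg y,
      mul_nonneg (sq_nonneg y) (by nlinarith [Real.pi_gt_three] : 0 ≤ Real.pi ^ 2 - 9)]
  unfold Complex.VerticalIntegrable
  simp only [hm]
  refine Integrable.mono' (integrable_inv_one_add_sq.const_mul
    (Real.Gamma c * (Real.pi / Real.sin (Real.pi * c)) * (1 / c))) ?_ (ae_of_all _ fun y => ?_)
  · refine Continuous.aestronglyMeasurable (continuous_iff_continuousAt.2 fun y => ?_)
    have hG : ContinuousAt Complex.Gamma (c + y * Complex.I) :=
      (Complex.differentiableAt_Gamma _ fun m h => by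
        have := congrArg Complex.re h
        simp at this
        have : (0 : ℝ) ≤ m := m.cast_nonneg
        linarith).continuousAt
    have h1 : Complex.sin (Real.pi * (c + y * Complex.I)) ≠ 0 := fun h => by
      have := hsn y
      rw [h, norm_zero] at this
      have : 0 < Real.sin (Real.pi * c) * (1 + y ^ 2) := by positivity
      linarith
    have h2 : (c + y * Complex.I : ℂ) ≠ 0 := fun h => by
      have := congrArg Complex.re h
      simp at this
      linarith
    refine ((ContinuousAt.comp (f := fun y : ℝ => (c + y * Complex.I : ℂ)) hG
      (by fun_prop)).mul (ContinuousAt.div (by fun_prop) (by fun_prop) h1)).mul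
      (ContinuousAt.div (by fun_prop) (by fun_prop) h2)
  · have hG : ‖Complex.Gamma (c + y * Complex.I)‖ ≤ Real.Gamma c := by
      simpa using norm_Gamma_le (s := c + y * Complex.I) (by simpa)
    have hn : c ≤ ‖(c + y * Complex.I : ℂ)‖ := by
      have := Complex.abs_re_le_norm (c + y * Complex.I : ℂ)
      simp only [Complex.add_re, Complex.ofReal_re, Complex.mul_re, Complex.I_re, mul_zero,
        Complex.ofReal_im, Complex.I_im, mul_one, sub_self, add_zero] at this
      rwa [abs_of_pos hc] at this
    rw [norm_mul, norm_mul, norm_div, norm_div, norm_one, Complex.norm_real,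
      Real.norm_of_nonneg Real.pi_pos.le]
    calc _ ≤ Real.Gamma c * (Real.pi / (Real.sin (Real.pi * c) * (1 + y ^ 2))) * (1 / c) := by
          have := Real.Gamma_pos_of_pos hc
          gcongr
          exact hsn y
      _ = _ := by field_simp

theorem specialG_eq_tailExpE1 {σ z : ℝ} (hσ : -1 < σ) (hσ0 : σ < 0) (hz : 0 < z) :
    specialG σ z = tailExpE1 z := by
  have hc : 0 < -σ := by linarith
  have hc1 : -σ < 1 := by linarith
  have h := mellinInv_mellin_eq (-σ) (fun z : ℝ => (tailExpE1 z : ℂ)) hz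
    (hasMellin_tailExpE1 (s := ((-σ : ℝ) : ℂ)) (by simpa using hσ0) (by simp; linarith)).1
    (verticalIntegrable_mellin_tailExpE1 hc hc1)
    (Complex.continuous_ofReal.continuousAt.comp (hasDerivAt_tailExpE1 hz).continuousAt)
  -- Reflecting `t ↦ -t` makes the Mellin variable `-s`, with `s` on the contour of the Meijer
  -- function.
  rw [← h, mellinInv, ← integral_neg_eq_self, specialG, meijerG, Complex.real_smul]
  push_cast
  congr 1
  refine integral_congr_ae (ae_of_all _ fun t => ?_)
  set s : ℂ := σ + t * Complex.I with hs
  have e : (-(σ : ℂ) + -(t : ℂ) * Complex.I) = -s := by rw [hs]; ring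
  have hre : s.re = σ := by simp [hs]
  simp only [e, neg_neg, smul_eq_mul]
  rw [(hasMellin_tailExpE1 (s := -s) (by simpa [hre] using hσ0)
    (by simp only [Complex.neg_re, hre]; linarith)).2]
  have hs0 : -s ≠ 0 := fun h0 => by
    have := congrArg Complex.re h0
    simp [hre] at this
    linarith
  have hG : Complex.Gamma (-s) ≠ 0 :=
    Complex.Gamma_ne_zero_of_re_pos (by simpa [hre] using hσ0)
  -- The denominator `Γ(1-s) = -s Γ(-s)` cancels one of the three factors `Γ(-s)` and leaves
  -- `1/(-s)`.
  have hk : meijerKernel 3 1 ![0, 1] ![0, 0, 0] s =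
      Complex.Gamma (-s) * (Complex.Gamma (1 - -s) * Complex.Gamma (-s)) * (1 / -s) := by
    have hG1 := Complex.Gamma_add_one (-s) hs0
    simp only [meijerKernel, Finset.prod_filter, Fin.prod_univ_three, Fin.prod_univ_two]
    simp
    rw [show 1 - s = -s + 1 by ring, hG1]
    have : s ≠ 0 := neg_ne_zero.1 hs0
    field_simp
  rw [hk]
  ring

/-! ### Uniqueness of the Whittaker function -/

theorem tendsto_mul_exp_neg_half_atTop :
    Tendsto (fun z : ℝ => Real.exp (-z / 2) * z) atTop (𝓝 0) := by
  have h := (Real.tendsto_pow_mul_exp_neg_atTop_nhds_zero 1).comp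
    (tendsto_id.atTop_div_const (show (0 : ℝ) < 2 by norm_num))
  refine (by simpa using h.const_mul 2 : Tendsto _ atTop (𝓝 (0 : ℝ))).congr fun z => ?_
  rw [neg_div]
  ring

namespace IsWhittakerW

variable {a b : ℂ} {w V : ℝ → ℂ}

theorem hasDerivAt (hw : IsWhittakerW a b w) {z : ℝ} (hz : 0 < z) : HasDerivAt w (deriv w z) z :=
  (hw.differentiableAt z hz).hasDerivAt

theorem hasDerivAt_deriv (hw : IsWhittakerW a b w) {z : ℝ} (hz : 0 < z) :
    HasDerivAt (deriv w) (-(-1 / 4 + a / (z : ℂ) + (1 / 4 - b ^ 2) / (z : ℂ) ^ 2) * w z) z :=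
  (hw.differentiableAt_deriv z hz).hasDerivAt.congr_deriv
    (by linear_combination hw.equation z hz)

/-- Two solutions agreeing to first order at a point agree to the left of it. -/
theorem eq_of_eq_of_deriv_eq (hw : IsWhittakerW a b w) (hV : IsWhittakerW a b V) {z t : ℝ}
    (hz : 0 < z) (hzt : z ≤ t) (h0 : w t = V t) (h1 : deriv w t = deriv V t) : w z = V z := by
  let q : ℝ → ℂ := fun s => -1 / 4 + a / (s : ℂ) + (1 / 4 - b ^ 2) / (s : ℂ) ^ 2
  let Q : ℝ := 1 / 4 + ‖a‖ / z + ‖1 / 4 - b ^ 2‖ / z ^ 2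
  have hQ : 0 ≤ Q := by positivity
  have hq : ∀ s, z ≤ s → ‖q s‖ ≤ Q := fun s hs => by
    have hs0 : 0 < s := hz.trans_le hs
    refine (norm_add₃_le).trans ?_
    rw [norm_div, norm_div, norm_div, norm_pow, Complex.norm_real, Real.norm_of_nonneg hs0.le]
    have : ‖(-1 : ℂ)‖ / ‖(4 : ℂ)‖ = 1 / 4 := by simp
    rw [this]
    show _ ≤ 1 / 4 + ‖a‖ / z + ‖1 / 4 - b ^ 2‖ / z ^ 2
    gcongr
  -- The first-order system for `(w, w')`; to the right of `z` its coefficient is bounded by `Q`, so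
  -- it is Lipschitz with constant `max 1 Q`.
  let v : ℝ → ℂ × ℂ → ℂ × ℂ := fun s p => (p.2, -q s * p.1)
  have hd : ∀ f : ℝ → ℂ, IsWhittakerW a b f → ∀ s, 0 < s →
      HasDerivAt (fun s => (f s, deriv f s)) (v s (f s, deriv f s)) s := fun f hf s hs =>
    (hf.hasDerivAt hs).prodMk (hf.hasDerivAt_deriv hs)
  have key := ODE_solution_unique_of_mem_Icc_left (v := v) (s := fun _ => Set.univ)
    (K := ⟨max 1 Q, le_max_of_le_left zero_le_one⟩)
    (f := fun s => (w s, deriv w s)) (g := fun s => (V s, deriv V s)) (a := z) (b := t)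
    (fun s hs => LipschitzWith.lipschitzOnWith (LipschitzWith.of_dist_le_mul fun p r => by
      have hm : (0 : ℝ) ≤ max 1 Q := le_max_of_le_left zero_le_one
      rw [Prod.dist_eq (x := v s p), max_le_iff]
      constructor
      · refine (le_max_right (dist p.1 r.1) (dist p.2 r.2)).trans ?_
        rw [← Prod.dist_eq]
        exact le_mul_of_one_le_left dist_nonneg (le_max_left 1 Q)
      · have e : dist (v s p).2 (v s r).2 = ‖q s‖ * dist p.1 r.1 := by
          simp only [v, dist_eq_norm, ← mul_sub, norm_mul, norm_neg]
        rw [e]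
        exact mul_le_mul ((hq s hs.1.le).trans (le_max_right 1 Q)) (le_max_left _ _)
          dist_nonneg hm))
    (fun s hs => (hd w hw s (hz.trans_le hs.1)).continuousAt.continuousWithinAt)
    (fun s hs => (hd w hw s (hz.trans hs.1)).hasDerivWithinAt) (fun _ _ => trivial)
    (fun s hs => (hd V hV s (hz.trans_le hs.1)).continuousAt.continuousWithinAt)
    (fun s hs => (hd V hV s (hz.trans hs.1)).hasDerivWithinAt) (fun _ _ => trivial)
    (by simp only [h0, h1])
  exact congrArg Prod.fst (key ⟨le_rfl, hzt⟩)

/-- A real-valued `W_{1,b}` is the only function with the defining properties. -/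
theorem eq_ofReal {V : ℝ → ℝ} (hw : IsWhittakerW 1 b w)
    (hV : IsWhittakerW 1 b fun z => (V z : ℂ)) {z : ℝ} (hz : 0 < z) : w z = V z := by
  set VC : ℝ → ℂ := fun z => (V z : ℂ) with hVC
  let N : ℝ → ℂ := fun z => Complex.exp (-(z : ℂ) / 2) * (z : ℂ) ^ (1 : ℂ)
  have hN : ∀ z, N z = ((Real.exp (-z / 2) * z : ℝ) : ℂ) := fun z => by
    simp only [N, Complex.cpow_one]; push_cast; rfl
  have hN0 : ∀ᶠ z in atTop, N z ≠ 0 := by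
    filter_upwards [eventually_gt_atTop 0] with z hz
    rw [hN, Complex.ofReal_ne_zero]
    positivity
  have hVne : ∀ᶠ z in atTop, VC z ≠ 0 := by
    filter_upwards [hV.normalized.eventually_ne one_ne_zero] with z h h0
    simp [h0] at h
  have hV0 : Tendsto VC atTop (𝓝 0) := by
    have hN0' : Tendsto N atTop (𝓝 0) := by
      have := (Complex.continuous_ofReal.tendsto 0).comp tendsto_mul_exp_neg_half_atTop
      rw [Complex.ofReal_zero] at this
      exact this.congr fun z => (hN z).symm
    have h := hV.normalized.mul hN0'
    rw [mul_zero] at h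
    refine h.congr' (hN0.mono fun z h => ?_)
    exact div_mul_cancel₀ _ h
  have hVle : ∀ᶠ z in atTop, V z ^ 2 ≤ 1 := by
    have h := (hV0.norm.eventually (gt_mem_nhds (show ‖(0 : ℂ)‖ < 1 by simp)))
    filter_upwards [h] with z h
    rw [hVC, Complex.norm_real, Real.norm_eq_abs] at h
    exact (sq_le_one_iff_abs_le_one _).2 h.le
  have hr : Tendsto (fun z => w z / VC z) atTop (𝓝 1) := by
    have h := hw.normalized.div hV.normalized one_ne_zero
    rw [div_one] at h
    refine h.congr' (hN0.mono fun z h => ?_)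
    exact div_div_div_cancel_right₀ h _ _
  -- The Wronskian is constant because the equation has no first-order term.
  obtain ⟨C, hC⟩ : ∃ C, ∀ z ∈ Set.Ioi (0 : ℝ), deriv w z * VC z - w z * deriv VC z = C := by
    have hd : ∀ z ∈ Set.Ioi (0 : ℝ),
        HasDerivAt (fun z => deriv w z * VC z - w z * deriv VC z) 0 z := fun z hz => by
      refine (((hw.hasDerivAt_deriv hz).mul (hV.hasDerivAt hz)).sub
        ((hw.hasDerivAt hz).mul (hV.hasDerivAt_deriv hz))).congr_deriv ?_
      ring
    exact isOpen_Ioi.exists_is_const_of_deriv_eq_zero isPreconnected_Ioi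
      (fun z hz => (hd z hz).differentiableAt.differentiableWithinAt) fun z hz => (hd z hz).deriv
  obtain ⟨R, hR⟩ := eventually_atTop.1 (((eventually_gt_atTop 0).and hVne).and hVle)
  have hrd : ∀ s, R ≤ s → HasDerivAt (fun z => w z / VC z) (C * (((V s ^ 2)⁻¹ : ℝ) : ℂ)) s := by
    intro s hs
    obtain ⟨⟨hs0, hne⟩, -⟩ := hR s hs
    refine ((hw.hasDerivAt hs0).div (hV.hasDerivAt hs0) hne).congr_deriv ?_
    rw [hC s hs0, div_eq_mul_inv]
    push_cast
    rfl
  -- Otherwise `w/(V C)` has derivative `1/V²`, which is real and eventually at least `1` since `V →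
  -- 0`. Its real part would then be unbounded, although `w/V → 1`.
  have hC0 : C = 0 := by
    by_contra hC0
    have hd : ∀ s, R ≤ s → HasDerivAt (fun z => (w z / VC z / C).re) ((V s ^ 2)⁻¹) s := by
      intro s hs
      have h := ((hrd s hs).div_const C)
      rw [mul_div_cancel_left₀ _ hC0] at h
      exact Complex.reCLM.hasFDerivAt.comp_hasDerivAt s h
    have hmono : MonotoneOn (fun z => (w z / VC z / C).re - z) (Set.Ici R) := by
      refine monotoneOn_of_hasDerivWithinAt_nonneg (convex_Ici R)
        (f' := fun s => (V s ^ 2)⁻¹ - 1) (fun s hs => ?_) (fun s hs => ?_) fun s hs => ?_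
      · exact ((hd s hs).sub (hasDerivAt_id s)).continuousAt.continuousWithinAt
      · rw [interior_Ici] at hs
        exact ((hd s (le_of_lt hs)).sub (hasDerivAt_id s)).hasDerivWithinAt
      · rw [interior_Ici] at hs
        obtain ⟨⟨-, hne⟩, hle⟩ := hR s (le_of_lt hs)
        have : V s ≠ 0 := Complex.ofReal_ne_zero.1 hne
        exact sub_nonneg.2 ((one_le_inv₀ (by positivity)).2 hle)
    have hlim : Tendsto (fun z => (w z / VC z / C).re) atTop (𝓝 (1 / C).re) :=
      (Complex.continuous_re.tendsto _).comp (hr.div_const C)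
    refine not_tendsto_nhds_of_tendsto_atTop ?_ _ hlim
    refine tendsto_atTop_mono' atTop ?_ (tendsto_atTop_add_const_left atTop
      ((w R / VC R / C).re - R) tendsto_id)
    filter_upwards [eventually_ge_atTop R] with s hs
    have := hmono Set.self_mem_Ici hs hs
    simp only [id] at this ⊢
    linarith
  have hwV : ∀ s, R < s → w s = VC s := by
    obtain ⟨c, hc⟩ : ∃ c, ∀ s ∈ Set.Ioi R, w s / VC s = c := by
      have hd : ∀ s ∈ Set.Ioi R, HasDerivAt (fun z => w z / VC z) 0 s := fun s hs => by
        simpa [hC0] using hrd s (le_of_lt hs)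
      exact isOpen_Ioi.exists_is_const_of_deriv_eq_zero isPreconnected_Ioi
        (fun z hz => (hd z hz).differentiableAt.differentiableWithinAt) fun z hz => (hd z hz).deriv
    have hc1 : c = 1 := by
      refine tendsto_nhds_unique (Tendsto.congr' ?_ tendsto_const_nhds) hr
      filter_upwards [eventually_gt_atTop R] with s hs using (hc s hs).symm
    intro s hs
    have := hc s hs
    rwa [hc1, div_eq_one_iff_eq (hR s hs.le).1.2] at this
  have ht : R < max z R + 1 := lt_of_le_of_lt (le_max_right z R) (lt_add_one _)
  have hev : w =ᶠ[𝓝 (max z R + 1)] VC := by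
    filter_upwards [Ioi_mem_nhds ht] with s hs using hwV s hs
  -- Equality near a point beyond both `z` and `R` propagates down to `z`.
  exact hw.eq_of_eq_of_deriv_eq hV hz ((le_max_left z R).trans (lt_add_one _).le)
    hev.self_of_nhds hev.deriv_eq

end IsWhittakerW

/-! ### The Whittaker function as a Volterra series -/

theorem tendsto_volterraSol_sub_atTop (ε : ℝ) {k : ℕ} (hk : k ≠ 0) :
    Tendsto (fun z => volterraSol ε z - ∑ n ∈ Finset.range k, ε ^ n * volterraIter n z)
      atTop (𝓝 0) := by
  have h0 : Tendsto (fun z : ℝ => |ε| / z) atTop (𝓝 0) := tendsto_const_nhds.div_atTop tendsto_id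
  have h1 : Tendsto (fun z : ℝ => (|ε| / z) ^ k * Real.exp (|ε| / z)) atTop (𝓝 0) := by
    have h := (h0.pow k).mul ((Real.continuous_exp.tendsto 0).comp h0)
    simpa [zero_pow hk] using! h
  refine squeeze_zero_norm' ?_ h1
  filter_upwards [eventually_gt_atTop 0] with z hz using abs_volterraSol_sub_le ε k hz

theorem tendsto_volterraSol_atTop (ε : ℝ) : Tendsto (volterraSol ε) atTop (𝓝 1) := by
  have h := (tendsto_volterraSol_sub_atTop ε one_ne_zero).add_const 1
  simpa [volterraIter] using h

theorem tendsto_sum_volterraIter_atTop (ε : ℝ) {k : ℕ} (hk : k ≠ 0) :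
    Tendsto (fun z => ∑ n ∈ Finset.range k, ε ^ n * volterraIter n z) atTop (𝓝 1) := by
  have h := (tendsto_volterraSol_atTop ε).sub (tendsto_volterraSol_sub_atTop ε hk)
  simpa using h

/-- The solution `e^{-z/2} z u(z)` of Whittaker's equation with `a = 1`, `1/4 - b² = -ε`. -/
noncomputable def whittakerSol (ε z : ℝ) : ℝ := Real.exp (-z / 2) * z * volterraSol ε z

theorem hasDerivAt_whittakerSol (ε : ℝ) {z : ℝ} (hz : 0 < z) :
    HasDerivAt (whittakerSol ε) (Real.exp (-z / 2) *
      ((1 - z / 2) * volterraSol ε z + z * volterraSolDeriv ε z)) z := by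
  refine ((((hasDerivAt_neg z).div_const 2).exp.mul (hasDerivAt_id z)).mul
    (hasDerivAt_volterraSol ε hz)).congr_deriv ?_
  simp only [Pi.mul_apply, id]
  ring

theorem hasDerivAt_deriv_whittakerSol (ε : ℝ) {z : ℝ} (hz : 0 < z) :
    HasDerivAt (fun z => Real.exp (-z / 2) *
      ((1 - z / 2) * volterraSol ε z + z * volterraSolDeriv ε z))
      (-(-1 / 4 + 1 / z - ε / z ^ 2) * whittakerSol ε z) z := by
  refine (((hasDerivAt_neg z).div_const 2).exp.mul
    (((((hasDerivAt_id z).div_const 2).const_sub 1).mul (hasDerivAt_volterraSol ε hz)).add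
      ((hasDerivAt_id z).mul (hasDerivAt_volterraSolDeriv ε hz)))).congr_deriv ?_
  simp only [Pi.mul_apply, Pi.add_apply, id, whittakerSol]
  field_simp
  ring

theorem isWhittakerW_whittakerSol {ε : ℝ} {b : ℂ} (hb : 1 / 4 - b ^ 2 = -(ε : ℂ)) :
    IsWhittakerW 1 b fun z => (whittakerSol ε z : ℂ) := by
  have h1 : ∀ z : ℝ, 0 < z → HasDerivAt (fun z => (whittakerSol ε z : ℂ)) _ z :=
    fun z hz => (hasDerivAt_whittakerSol ε hz).ofReal_comp
  have h2 : ∀ z : ℝ, 0 < z → HasDerivAt (deriv fun z => (whittakerSol ε z : ℂ)) _ z :=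
    fun z hz => (hasDerivAt_deriv_whittakerSol ε hz).ofReal_comp.congr_of_eventuallyEq
      (by filter_upwards [Ioi_mem_nhds hz] with s hs using (h1 s hs).deriv)
  refine ⟨fun z hz => (h1 z hz).differentiableAt, fun z hz => (h2 z hz).differentiableAt,
    fun z hz => ?_, ?_⟩
  · rw [(h2 z hz).deriv, hb]
    push_cast
    ring
  · have h := (Complex.continuous_ofReal.tendsto 1).comp (tendsto_volterraSol_atTop ε)
    rw [Complex.ofReal_one] at h
    refine h.congr' ?_
    filter_upwards [eventually_gt_atTop 0] with z hz
    have hz' : (z : ℂ) ≠ 0 := Complex.ofReal_ne_zero.2 hz.ne'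
    have := Complex.exp_ne_zero (-(z : ℂ) / 2)
    simp only [Function.comp, whittakerSol, Complex.cpow_one]
    push_cast
    field_simp

theorem whittakerW_eq_whittakerSol {ε : ℝ} {b : ℂ} (hb : 1 / 4 - b ^ 2 = -(ε : ℂ)) {z : ℝ}
    (hz : 0 < z) : whittakerW 1 b z = whittakerSol ε z := by
  have h : ∃ w, IsWhittakerW 1 b w := ⟨_, isWhittakerW_whittakerSol hb⟩
  rw [whittakerW, dif_pos h]
  exact h.choose_spec.eq_ofReal (isWhittakerW_whittakerSol hb) hz

/-! ### The expansion in `lam` -/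

theorem xi_sq (μ lam : ℝ) : xi μ lam ^ 2 = ((1 + 8 / μ ^ 2 * lam : ℝ) : ℂ) := by
  have h := Complex.cpow_nat_inv_pow ((1 + 8 / μ ^ 2 * lam : ℝ) : ℂ) two_ne_zero
  rw [xi, one_div]
  exact_mod_cast h

/-- Only `ξ²` enters the equation, and `1/4 - ξ²/4 = -2λ/μ²`; imaginary `ξ` therefore needs no
separate treatment. -/
theorem whittakerW_xi_eq (μ lam : ℝ) {z : ℝ} (hz : 0 < z) :
    whittakerW 1 (xi μ lam / 2) z = whittakerSol (2 / μ ^ 2 * lam) z := by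
  refine whittakerW_eq_whittakerSol ?_ hz
  rw [div_pow, xi_sq]
  push_cast
  ring

theorem thirdOrderExpansion_eq {σ μ x lam : ℝ} (hσ : -1 < σ) (hσ0 : σ < 0) (hμ : μ ≠ 0)
    (hx : 0 < x) : thirdOrderExpansion σ μ x lam =
      ((Real.exp (-(2 / (μ ^ 2 * x)) / 2) * (2 / (μ ^ 2 * x)) * ∑ n ∈ Finset.range 4,
        (2 / μ ^ 2 * lam) ^ n * volterraIter n (2 / (μ ^ 2 * x)) : ℝ) : ℂ) := by
  set z : ℝ := 2 / (μ ^ 2 * x) with hzdef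
  have hz : 0 < z := by positivity
  have hxz : x = 2 / (μ ^ 2 * z) := by rw [hzdef]; field_simp
  have he : -1 / (μ ^ 2 * x) = -z / 2 := by rw [hzdef]; field_simp
  have hL : funL σ z = realL z := by
    rw [funL, specialG_eq_tailExpE1 hσ hσ0 hz, realL, expE1]
    push_cast
    rfl
  rw [thirdOrderExpansion, ← hzdef, hL, specialG_eq_tailExpE1 hσ hσ0 hz, he]
  -- The prefactor `z` cancels the `1/z` in iterates one to three, and for the zeroth it equals
  -- `(2/μ²)(1/x)`.
  have hreal : (2 / μ ^ 2 * Real.exp (-z / 2)) * (1 / x + lam + 2 / μ ^ 2 * realL z * lam ^ 2 +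
      (2 / μ ^ 2) ^ 2 * (tailExpE1 z - 2 * realL z) * lam ^ 3) =
      Real.exp (-z / 2) * z * ∑ n ∈ Finset.range 4, (2 / μ ^ 2 * lam) ^ n * volterraIter n z := by
    simp only [Finset.sum_range_succ, Finset.sum_range_zero, volterraIter_one hz,
      volterraIter_two hz, volterraIter_three hz]
    simp only [volterraIter, hxz]
    field_simp
    ring
  rw [← hreal]
  push_cast
  rfl

theorem theorem3p4 (μ : ℝ) (hμ : μ ≠ 0) (σ : ℝ)
    (hσ : SeparatesPoles 3 1 (![0, 1] : Fin 2 → ℂ) (![0, 0, 0] : Fin 3 → ℂ) σ) :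
    (∀ x : ℝ, 0 < x →
      (fun lam : ℝ => whittakerW 1 (xi μ lam / 2) (2 / (μ ^ 2 * x)) -
          thirdOrderExpansion σ μ x lam)
        =O[𝓝 0] fun lam : ℝ => lam ^ 4) ∧
    -- at `x = 0` both sides are read as limits for `x → 0+`
    (∀ lam : ℝ,
      Tendsto (fun x : ℝ => whittakerW 1 (xi μ lam / 2) (2 / (μ ^ 2 * x))) (𝓝[>] 0) (𝓝 0) ∧
      Tendsto (fun x : ℝ => thirdOrderExpansion σ μ x lam) (𝓝[>] 0) (𝓝 0)) := by
  have hσ1 : -1 < σ := by simpa using hσ.1 0 (by simp)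
  have hσ0 : σ < 0 := by simpa using hσ.2 0 (by simp)
  refine ⟨fun x hx => ?_, fun lam => ?_⟩
  · set z : ℝ := 2 / (μ ^ 2 * x) with hzdef
    have hz : 0 < z := by positivity
    set c : ℝ := |2 / μ ^ 2|
    refine IsBigO.of_bound (Real.exp (-z / 2) * z * ((c / z) ^ 4 * Real.exp (c / z))) ?_
    -- The restriction `|lam| < 1` serves only to bound the exponential factor of the remainder by a
    -- constant.
    filter_upwards [Metric.ball_mem_nhds (0 : ℝ) one_pos] with lam hlam
    have hlam : |lam| < 1 := by simpa using hlam
    rw [whittakerW_xi_eq μ lam hz, thirdOrderExpansion_eq hσ1 hσ0 hμ hx, ← hzdef,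
      ← Complex.ofReal_sub, Complex.norm_real, whittakerSol, ← mul_sub, norm_mul,
      Real.norm_of_nonneg (by positivity : 0 ≤ Real.exp (-z / 2) * z), Real.norm_eq_abs,
      mul_assoc _ _ ‖lam ^ 4‖]
    refine mul_le_mul_of_nonneg_left ?_ (by positivity)
    refine (abs_volterraSol_sub_le _ 4 hz).trans ?_
    rw [abs_mul, norm_pow, Real.norm_eq_abs]
    calc (c * |lam| / z) ^ 4 * Real.exp (c * |lam| / z)
        ≤ (c * |lam| / z) ^ 4 * Real.exp (c * 1 / z) := by gcongr
      _ = _ := by rw [mul_one]; ring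
  · have hz : Tendsto (fun x : ℝ => 2 / (μ ^ 2 * x)) (𝓝[>] 0) atTop := by
      refine (tendsto_inv_nhdsGT_zero.const_mul_atTop
        (show (0 : ℝ) < 2 / μ ^ 2 by positivity)).congr fun x => ?_
      rw [← div_div, div_eq_mul_inv (2 / μ ^ 2)]
    have lim : ∀ f : ℝ → ℝ, Tendsto f atTop (𝓝 1) → Tendsto (fun x : ℝ =>
        ((Real.exp (-(2 / (μ ^ 2 * x)) / 2) * (2 / (μ ^ 2 * x)) * f (2 / (μ ^ 2 * x)) : ℝ) : ℂ))
        (𝓝[>] 0) (𝓝 0) := fun f hf => by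
      have h := (tendsto_mul_exp_neg_half_atTop.mul hf).comp hz
      rw [zero_mul] at h
      rw [← Complex.ofReal_zero]
      exact (Complex.continuous_ofReal.tendsto 0).comp h
    constructor
    · refine (lim _ (tendsto_volterraSol_atTop (2 / μ ^ 2 * lam))).congr' ?_
      filter_upwards [self_mem_nhdsWithin] with x hx
      have hx : 0 < x := hx
      exact (whittakerW_xi_eq μ lam (by positivity)).symm
    · refine (lim _ (tendsto_sum_volterraIter_atTop (2 / μ ^ 2 * lam) four_ne_zero)).congr' ?_
      filter_upwards [self_mem_nhdsWithin] with x hx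
      exact (thirdOrderExpansion_eq hσ1 hσ0 hμ hx).symm
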